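/- Let $A\in\mathbb{R}^{n\times n}$ be nonsingular, $B\in\mathbb{R}^{n\times m}$ with $(A,B)$ controllable, $Q\in\mathbb{R}^{n\times n}$ symmetric positive semidefinite and $R\in\mathbb{R}^{m\times m}$ symmetric positive definite. Call $K\in\mathbb{R}^{m\times n}$ a stabilizing derivative-feedback gain for $\dot x=Ax+Bu$ if, under $u=-K\dot x$, the closed loop $(I+BK)\dot x=Ax$ is such that $I+BK$ is invertible and $(I+BK)^{-1}A$ is Hurwitz (all eigenvalues have negative real part). Consider the algebraic Riccati equation $$P A^{-1}+A^{-T}P-PA^{-1}BR^{-1}B^{T}A^{-T}P+Q=0. \tag{ARE}$$ Let $K_1$ be any stabilizing derivative-feedback gain. If $(Q^{1/2},A)$ is observable, then (ARE) has a positive definite solution. Moreover, whenever (ARE) has a positive definite solution $P^*$, it is the only positive definite solution and, with $K^*=-R^{-1}B^{T}A^{-T}P^*$, the following holds. Starting from $K_1$, for $i=1,2,\dots$ the equation $$P_iA_i^{-1}+A_i^{-T}P_i+Q+K_i^{T}RK_i=0,\qquad A_i^{-1}:=A^{-1}(I+BK_i),$$ has a unique positive definite solution $P_i$, and one defines $$K_{i+1}=-R^{-1}B^{T}A^{-T}P_i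 .$$ For all $i\ge 1$: 1. $I+BK_{i+1}$ is invertible and $(I+BK_{i+1})^{-1}A$ is Hurwitz; 2. $P^*\le P_{i+1}\le P_i$ in the positive semidefinite order; 3. $\lim_{i\to\infty}P_i=P^*$ and $\lim_{i\to\infty}K_i=K^*$. -/

import Mathlib

open Matrix Filter Topology

noncomputable section

namespace DFC

variable {n m : ℕ}

/-- A real square matrix is Hurwitz if all its complex eigenvalues have negative real part. -/
def IsHurwitz (M : Matrix (Fin n) (Fin n) ℝ) : Prop :=
  ∀ μ ∈ spectrum ℂ (M.map (algebraMap ℝ ℂ)), μ.re < 0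

/-- The controllability matrix `[B, AB, …, Aⁿ⁻¹B]`; column `(k, j)` is column `j` of `Aᵏ B`. -/
def controllabilityMatrix (A : Matrix (Fin n) (Fin n) ℝ) (B : Matrix (Fin n) (Fin m) ℝ) :
    Matrix (Fin n) (Fin n × Fin m) ℝ :=
  Matrix.of fun i kj => (A ^ (kj.1 : ℕ) * B) i kj.2

/-- Controllability of `ẋ = A x + B u` (Kalman rank condition). -/
def IsControllable (A : Matrix (Fin n) (Fin n) ℝ) (B : Matrix (Fin n) (Fin m) ℝ) : Prop :=
  (controllabilityMatrix A B).rank = n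

/-- The observability matrix with block rows `C, CA, …, CAⁿ⁻¹`. -/
def observabilityMatrix (C A : Matrix (Fin n) (Fin n) ℝ) :
    Matrix (Fin n × Fin n) (Fin n) ℝ :=
  Matrix.of fun ki j => (C * A ^ (ki.1 : ℕ)) ki.2 j

/-- Observability of the pair `(C, A)` (Kalman rank condition). -/
def IsObservable (C A : Matrix (Fin n) (Fin n) ℝ) : Prop :=
  (observabilityMatrix C A).rank = n

/-- `K` is a stabilizing derivative-feedback gain: under `u = -K ẋ` the closed loop
`(I + B K) ẋ = A x` is a well-posed ODE, and its matrix `(I + B K)⁻¹ A` is Hurwitz. -/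
def IsStabilizing (A : Matrix (Fin n) (Fin n) ℝ) (B : Matrix (Fin n) (Fin m) ℝ)
    (K : Matrix (Fin m) (Fin n) ℝ) : Prop :=
  IsUnit (1 + B * K).det ∧ IsHurwitz ((1 + B * K)⁻¹ * A)

/-- `P` solves the algebraic Riccati equation of the derivative-feedback LQR problem. -/
def SolvesARE (A : Matrix (Fin n) (Fin n) ℝ) (B : Matrix (Fin n) (Fin m) ℝ)
    (Q : Matrix (Fin n) (Fin n) ℝ) (R : Matrix (Fin m) (Fin m) ℝ)
    (P : Matrix (Fin n) (Fin n) ℝ) : Prop :=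
  P * A⁻¹ + A⁻¹ᵀ * P - P * A⁻¹ * B * R⁻¹ * Bᵀ * A⁻¹ᵀ * P + Q = 0

/-- The gain `-R⁻¹ Bᵀ A⁻ᵀ P` belonging to `P`. -/
def gain (A : Matrix (Fin n) (Fin n) ℝ) (B : Matrix (Fin n) (Fin m) ℝ)
    (R : Matrix (Fin m) (Fin m) ℝ) (P : Matrix (Fin n) (Fin n) ℝ) :
    Matrix (Fin m) (Fin n) ℝ :=
  -(R⁻¹ * Bᵀ * A⁻¹ᵀ * P)

/-- The matrix `A⁻¹ (I + B K)`, the inverse of the closed-loop matrix. -/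
def closedLoopInv (A : Matrix (Fin n) (Fin n) ℝ) (B : Matrix (Fin n) (Fin m) ℝ)
    (K : Matrix (Fin m) (Fin n) ℝ) : Matrix (Fin n) (Fin n) ℝ :=
  A⁻¹ * (1 + B * K)

/-- `P` solves the policy-evaluation (Lyapunov) equation for the gain `K`. -/
def SolvesLyapunov (A : Matrix (Fin n) (Fin n) ℝ) (B : Matrix (Fin n) (Fin m) ℝ)
    (Q : Matrix (Fin n) (Fin n) ℝ) (R : Matrix (Fin m) (Fin m) ℝ)
    (K : Matrix (Fin m) (Fin n) ℝ) (P : Matrix (Fin n) (Fin n) ℝ) : Prop :=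
  P * closedLoopInv A B K + (closedLoopInv A B K)ᵀ * P + Q + Kᵀ * R * K = 0

/-- `(P i, K i)`, `i = 1, 2, …`, is a run of policy iteration started from the gain `K₁`.
The entries at index `0` play no role. -/
structure IsPolicyIteration (A : Matrix (Fin n) (Fin n) ℝ) (B : Matrix (Fin n) (Fin m) ℝ)
    (Q : Matrix (Fin n) (Fin n) ℝ) (R : Matrix (Fin m) (Fin m) ℝ)
    (K₁ : Matrix (Fin m) (Fin n) ℝ)
    (P : ℕ → Matrix (Fin n) (Fin n) ℝ) (K : ℕ → Matrix (Fin m) (Fin n) ℝ) : Prop where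
  init : K 1 = K₁
  posDef : ∀ i, 1 ≤ i → (P i).PosDef
  evaluation : ∀ i, 1 ≤ i → SolvesLyapunov A B Q R (K i) (P i)
  improvement : ∀ i, 1 ≤ i → K (i + 1) = gain A B R (P i)

end DFC

end

/-! Inverting a matrix preserves the sign of the real parts of its eigenvalues, so a gain is
stabilizing iff `closedLoopInv` is Hurwitz. This reduces the claim to Kleinman's iteration for the
pair `(A⁻¹, A⁻¹ * B)`. The engine is `lyapunov_eq_riccati_add`: the Lyapunov residual at `(K, P)` is
the Riccati residual at `P` plus a square in `K - gain A B R P`. With the Lyapunov theory of Hurwitz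
matrices, it shows that improvement keeps stability, that the costs decrease, and that they dominate
every Hermitian Riccati solution. The iterates therefore converge, and their limit solves the
Riccati equation. Observability makes this limit definite, which gives existence
(`SolvesARE.posDef`). Controllability makes any definite solution stabilizing
(`SolvesARE.isHurwitz`). Two such solutions then dominate each other, so they coincide, and the
limit, which lies above `Pstar`, equals it. -/

namespace DFC

variable {n m : ℕ}

/-! ### Hurwitz matrices and their eigenvectors -/

lemma mem_spectrum_iff_exists_mulVec {M : Matrix (Fin n) (Fin n) ℂ} {μ : ℂ} :
    μ ∈ spectrum ℂ M ↔ ∃ v ≠ 0, M *ᵥ v = μ • v := by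
  rw [← Matrix.spectrum_toLin', ← Module.End.hasEigenvalue_iff_mem_spectrum]
  constructor
  · intro h
    obtain ⟨v, hv⟩ := h.exists_hasEigenvector
    exact ⟨v, hv.2, by simpa using hv.apply_eq_smul⟩
  · rintro ⟨v, hv, h⟩
    exact Module.End.hasEigenvalue_of_hasEigenvector
      ⟨Module.End.mem_eigenspace_iff.2 (by simpa using h), hv⟩

lemma map_mulVec_re (M : Matrix (Fin n) (Fin n) ℝ) (v : Fin n → ℂ) (i : Fin n) :
    ((M.map (algebraMap ℝ ℂ) *ᵥ v) i).re = (M *ᵥ fun j => (v j).re) i := by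
  simp [mulVec, dotProduct]

lemma map_mulVec_im (M : Matrix (Fin n) (Fin n) ℝ) (v : Fin n → ℂ) (i : Fin n) :
    ((M.map (algebraMap ℝ ℂ) *ᵥ v) i).im = (M *ᵥ fun j => (v j).im) i := by
  simp [mulVec, dotProduct]

/-- Hurwitz matrices in terms of real and imaginary parts of complex eigenvectors. -/
lemma isHurwitz_iff {M : Matrix (Fin n) (Fin n) ℝ} :
    IsHurwitz M ↔ ∀ (a b : Fin n → ℝ) (α β : ℝ), M *ᵥ a = α • a - β • b →
      M *ᵥ b = β • a + α • b → 0 ≤ α → a = 0 ∧ b = 0 := by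
  constructor
  · intro h a b α β ha hb hα
    by_contra hab
    refine absurd (h ⟨α, β⟩ (mem_spectrum_iff_exists_mulVec.2
      ⟨fun j => ⟨a j, b j⟩, ?_, ?_⟩)) (not_lt.2 hα)
    · intro h0
      refine hab ⟨?_, ?_⟩ <;> ext j
      · exact congrArg Complex.re (congrFun h0 j)
      · exact congrArg Complex.im (congrFun h0 j)
    · ext i
      apply Complex.ext
      · rw [map_mulVec_re]
        simp [ha]
      · rw [map_mulVec_im]
        simp [hb]
        ring
  · intro h μ hμ
    obtain ⟨v, hv, hMv⟩ := mem_spectrum_iff_exists_mulVec.1 hμ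
    by_contra hre
    obtain ⟨h1, h2⟩ := h (fun j => (v j).re) (fun j => (v j).im) μ.re μ.im
      (by ext i; rw [← map_mulVec_re, hMv]; simp)
      (by ext i; rw [← map_mulVec_im, hMv]; simp; ring) (not_lt.1 hre)
    exact hv (funext fun j => Complex.ext (congrFun h1 j) (congrFun h2 j))

lemma IsHurwitz.isUnit_det {M : Matrix (Fin n) (Fin n) ℝ} (h : IsHurwitz M) :
    IsUnit M.det := by
  rw [isUnit_iff_ne_zero]
  intro h0
  obtain ⟨v, hv, hM⟩ := Matrix.exists_mulVec_eq_zero_iff.2 h0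
  exact hv (isHurwitz_iff.1 h v 0 0 0 (by simp [hM]) (by simp) le_rfl).1

lemma IsHurwitz.of_mul_eq_one {M T : Matrix (Fin n) (Fin n) ℝ} (hT : IsHurwitz T)
    (h : T * M = 1) : IsHurwitz M := by
  rw [isHurwitz_iff] at hT ⊢
  intro a b α β ha hb hα
  have ea : a = α • T *ᵥ a - β • T *ᵥ b := by
    rw [← mulVec_smul, ← mulVec_smul, ← mulVec_sub, ← ha, mulVec_mulVec, h, one_mulVec]
  have eb : b = β • T *ᵥ a + α • T *ᵥ b := by
    rw [← mulVec_smul, ← mulVec_smul, ← mulVec_add, ← hb, mulVec_mulVec, h, one_mulVec]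
  by_cases h0 : α ^ 2 + β ^ 2 = 0
  · have h1 : α = 0 := by nlinarith
    have h2 : β = 0 := by nlinarith
    subst h1 h2
    exact ⟨by simpa using ea, by simpa using eb⟩
  -- These are the real and imaginary parts of `1 / (α + iβ)`, the eigenvalue of the inverse.
  · refine hT a b (α / (α ^ 2 + β ^ 2)) (-β / (α ^ 2 + β ^ 2)) ?_ ?_ (by positivity)
    · ext i
      have e1 := congrFun ea i
      have e2 := congrFun eb i
      simp only [Pi.add_apply, Pi.sub_apply, Pi.smul_apply, smul_eq_mul] at e1 e2 ⊢
      field_simp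
      linear_combination (-α) * e1 - β * e2
    · ext i
      have e1 := congrFun ea i
      have e2 := congrFun eb i
      simp only [Pi.add_apply, Pi.sub_apply, Pi.smul_apply, smul_eq_mul] at e1 e2 ⊢
      field_simp
      linear_combination β * e1 - α * e2

/-! ### Powers of the Cayley transform -/

section Powers

attribute [local instance] Matrix.linftyOpNormedRing Matrix.linftyOpNormedAlgebra

/-- By Gelfand's formula `‖C ^ k‖ ^ (1/k)` tends to the spectral radius, so `‖C ^ k‖` is eventually
below `r ^ k` for some `r < 1`. -/
lemma tendsto_pow_zero_of_spectrum {C : Matrix (Fin n) (Fin n) ℂ}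
    (h : ∀ μ ∈ spectrum ℂ C, ‖μ‖ < 1) : Tendsto (fun k : ℕ => C ^ k) atTop (𝓝 0) := by
  rcases subsingleton_or_nontrivial (Matrix (Fin n) (Fin n) ℂ) with hs | hs
  · exact tendsto_const_nhds.congr fun k => Subsingleton.elim _ _
  have hr : spectralRadius ℂ C < ((1 : NNReal) : ENNReal) :=
    spectrum.spectralRadius_lt_of_forall_lt C h
  obtain ⟨r, hr1, hr2⟩ := ENNReal.lt_iff_exists_nnreal_btwn.1 hr
  rw [ENNReal.coe_lt_coe] at hr2
  have ht := spectrum.pow_nnnorm_pow_one_div_tendsto_nhds_spectralRadius C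
  have hev := ht.eventually (gt_mem_nhds hr1)
  refine squeeze_zero_norm' (a := fun k : ℕ => (r : ℝ) ^ k) ?_
    (tendsto_pow_atTop_nhds_zero_of_lt_one r.2 hr2)
  filter_upwards [hev, eventually_gt_atTop 0] with k hk hk0
  have hk0' : (0 : ℝ) < k := by exact_mod_cast hk0
  have h2 := ENNReal.rpow_le_rpow hk.le hk0'.le
  rw [← ENNReal.rpow_mul, one_div, inv_mul_cancel₀ hk0'.ne', ENNReal.rpow_one,
    ENNReal.rpow_natCast] at h2
  exact_mod_cast h2

end Powers

/-- The Cayley transform of a matrix. -/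
noncomputable def cayley (M : Matrix (Fin n) (Fin n) ℝ) : Matrix (Fin n) (Fin n) ℝ :=
  (1 + M) * (1 - M)⁻¹

lemma IsHurwitz.isUnit_det_one_sub {M : Matrix (Fin n) (Fin n) ℝ} (h : IsHurwitz M) :
    IsUnit (1 - M).det := by
  rw [isUnit_iff_ne_zero]
  intro h0
  obtain ⟨v, hv, hM⟩ := Matrix.exists_mulVec_eq_zero_iff.2 h0
  rw [sub_mulVec, one_mulVec, sub_eq_zero] at hM
  exact hv (isHurwitz_iff.1 h v 0 1 0 (by simp [← hM]) (by simp) zero_le_one).1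

lemma norm_lt_one_of_cayley_re_neg {μ ν : ℂ} (h : (1 + μ) * ν = μ - 1)
    (hν : ν.re < 0) : ‖μ‖ < 1 := by
  have h1 : ‖1 + ν‖ ^ 2 < ‖1 - ν‖ ^ 2 := by
    rw [← Complex.normSq_eq_norm_sq, ← Complex.normSq_eq_norm_sq, Complex.normSq_apply,
      Complex.normSq_apply]
    simp
    nlinarith
  have h2 : ‖μ‖ * ‖1 - ν‖ = ‖1 + ν‖ := by
    rw [← norm_mul]
    congr 1
    linear_combination -h
  have h3 : ‖1 + ν‖ < ‖1 - ν‖ := lt_of_pow_lt_pow_left₀ 2 (norm_nonneg _) h1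
  rw [← h2] at h3
  by_contra hc
  nlinarith [norm_nonneg (1 - ν)]

lemma IsHurwitz.tendsto_cayley_pow {M : Matrix (Fin n) (Fin n) ℝ} (h : IsHurwitz M) :
    Tendsto (fun k : ℕ => cayley M ^ k) atTop (𝓝 0) := by
  have key : Tendsto (fun k : ℕ => (cayley M).map (algebraMap ℝ ℂ) ^ k) atTop (𝓝 0) := by
    refine tendsto_pow_zero_of_spectrum fun μ hμ => ?_
    obtain ⟨v, hv, hCv⟩ := mem_spectrum_iff_exists_mulVec.1 hμ
    set Mc := M.map (algebraMap ℝ ℂ) with hMc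
    set N := ((1 - M)⁻¹).map (algebraMap ℝ ℂ) with hN
    have hinv : (1 - Mc) * N = 1 := by
      have := congrArg (algebraMap ℝ ℂ).mapMatrix
        (Matrix.mul_nonsing_inv (1 - M) h.isUnit_det_one_sub)
      rwa [map_mul, map_sub, map_one] at this
    have hC : (cayley M).map (algebraMap ℝ ℂ) = (1 + Mc) * N := by
      change (algebraMap ℝ ℂ).mapMatrix (cayley M) = _
      rw [cayley, map_mul, map_add, map_one]
      rfl
    set w := N *ᵥ v with hw
    have hvw : v = w - Mc *ᵥ w := by
      rw [← one_mulVec v, ← hinv, ← mulVec_mulVec, ← hw, sub_mulVec, one_mulVec]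
    have hw0 : w ≠ 0 := by
      intro h0
      apply hv
      rw [hvw, h0]; simp
    have e : w + Mc *ᵥ w = μ • (w - Mc *ᵥ w) := by
      rw [← hvw, ← hCv, hC, ← mulVec_mulVec, ← hw, add_mulVec, one_mulVec]
    have e2 : (1 + μ) • Mc *ᵥ w = (μ - 1) • w := by
      ext i
      have := congrFun e i
      simp only [Pi.add_apply, Pi.sub_apply, Pi.smul_apply, smul_eq_mul] at this ⊢
      linear_combination this
    have hμ1 : 1 + μ ≠ 0 := by
      intro h0
      have : μ = -1 := by linear_combination h0
      rw [this] at e2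
      simp at e2
      norm_num at e2
      exact hw0 e2
    -- `w` is an eigenvector of `M`, and its eigenvalue is the inverse Cayley transform of `μ`.
    refine norm_lt_one_of_cayley_re_neg (ν := (μ - 1) / (1 + μ))
      (mul_div_cancel₀ _ hμ1) (h _ (mem_spectrum_iff_exists_mulVec.2 ⟨w, hw0, ?_⟩))
    rw [div_eq_inv_mul, mul_smul, ← e2, smul_smul, inv_mul_cancel₀ hμ1, one_smul]
  refine tendsto_pi_nhds.2 fun i => tendsto_pi_nhds.2 fun j => ?_
  have h2 := (tendsto_pi_nhds.1 ((tendsto_pi_nhds.1 key) i)) j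
  have h3 := (Complex.continuous_re.tendsto _).comp h2
  refine h3.congr fun k => ?_
  have : (cayley M).map (algebraMap ℝ ℂ) ^ k = (cayley M ^ k).map (algebraMap ℝ ℂ) :=
    (Matrix.map_pow (cayley M) (algebraMap ℝ ℂ) k).symm
  simp only [Function.comp, this]
  simp

/-- This turns the continuous-time Lyapunov equation into a discrete-time one, so that powers of
`cayley M` replace the matrix exponential. -/
lemma sub_cayley_conj {M : Matrix (Fin n) (Fin n) ℝ} (h : IsHurwitz M)
    (P : Matrix (Fin n) (Fin n) ℝ) :
    P - (cayley M)ᵀ * P * cayley M =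
      2 • ((1 - M)⁻¹ᵀ * (-(P * M + Mᵀ * P)) * (1 - M)⁻¹) := by
  set N := (1 - M)⁻¹ with hN
  have h1 : (1 - M) * N = 1 := Matrix.mul_nonsing_inv _ h.isUnit_det_one_sub
  have h2 : Nᵀ * (1 - Mᵀ) = 1 := by
    simpa using congrArg transpose h1
  calc P - (cayley M)ᵀ * P * cayley M
      = (Nᵀ * (1 - Mᵀ)) * P * ((1 - M) * N) - (cayley M)ᵀ * P * cayley M := by
        rw [h1, h2, Matrix.one_mul, Matrix.mul_one]
    _ = _ := by
        rw [cayley, transpose_mul, transpose_add, transpose_one, ← hN]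
        noncomm_ring

/-! ### Lyapunov equations for a Hurwitz matrix -/

/-- Solutions of a Lyapunov inequality for a Hurwitz matrix are positive semidefinite. -/
lemma IsHurwitz.posSemidef_of_lyapunov {M P : Matrix (Fin n) (Fin n) ℝ} (h : IsHurwitz M)
    (hP : P.IsHermitian) (hX : (-(P * M + Mᵀ * P)).PosSemidef) : P.PosSemidef := by
  set C := cayley M with hC
  have hstep : (P - Cᵀ * P * C).PosSemidef := by
    rw [sub_cayley_conj h, two_smul]
    have := hX.conjTranspose_mul_mul_same (1 - M)⁻¹
    rw [conjTranspose_eq_transpose_of_trivial] at this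
    exact this.add this
  -- Telescoping: the difference is a sum of congruent copies of `P - Cᵀ * P * C`. The subtracted
  -- term vanishes as `k → ∞`.
  have hk : ∀ k : ℕ, (P - (C ^ k)ᵀ * P * C ^ k).PosSemidef := by
    intro k
    induction k with
    | zero => simpa using PosSemidef.zero
    | succ k ih =>
      have h1 := hstep.conjTranspose_mul_mul_same (C ^ k)
      rw [conjTranspose_eq_transpose_of_trivial] at h1
      convert ih.add h1 using 1
      rw [pow_succ', transpose_mul]
      noncomm_ring
  refine PosSemidef.of_dotProduct_mulVec_nonneg hP fun x => ?_
  have hlim : Tendsto (fun k : ℕ => star x ⬝ᵥ ((P - (C ^ k)ᵀ * P * C ^ k) *ᵥ x)) atTop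
      (𝓝 (star x ⬝ᵥ ((P - 0ᵀ * P * 0) *ᵥ x))) := by
    have hcont : Continuous fun Y : Matrix (Fin n) (Fin n) ℝ =>
        star x ⬝ᵥ ((P - Yᵀ * P * Y) *ᵥ x) := by fun_prop
    exact (hcont.tendsto 0).comp h.tendsto_cayley_pow
  have := ge_of_tendsto' hlim fun k => (hk k).dotProduct_mulVec_nonneg x
  simpa using this

lemma IsHurwitz.eq_zero_of_lyapunov {M P : Matrix (Fin n) (Fin n) ℝ} (h : IsHurwitz M)
    (hP : P * M + Mᵀ * P = 0) : P = 0 := by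
  have h1 : P = (cayley M)ᵀ * P * cayley M := by
    have := sub_cayley_conj h P
    rwa [hP, neg_zero, Matrix.mul_zero, Matrix.zero_mul, smul_zero, sub_eq_zero] at this
  have hk : ∀ k : ℕ, (cayley M ^ k)ᵀ * P * cayley M ^ k = P := by
    intro k
    induction k with
    | zero => simp
    | succ k ih =>
      calc (cayley M ^ (k + 1))ᵀ * P * cayley M ^ (k + 1)
          = (cayley M ^ k)ᵀ * ((cayley M)ᵀ * P * cayley M) * cayley M ^ k := by
            rw [pow_succ', transpose_mul]; noncomm_ring
        _ = P := by rw [← h1, ih]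
  have hcont : Continuous fun Y : Matrix (Fin n) (Fin n) ℝ => Yᵀ * P * Y := by fun_prop
  have hlim := (hcont.tendsto 0).comp h.tendsto_cayley_pow
  have := tendsto_nhds_unique (hlim.congr hk) tendsto_const_nhds
  simpa using this.symm

/-- The Lyapunov operator is injective on a finite-dimensional space, hence surjective. Injectivity
also makes the solution symmetric, since its transpose solves the same equation. -/
lemma IsHurwitz.exists_lyapunov {M X : Matrix (Fin n) (Fin n) ℝ} (h : IsHurwitz M)
    (hX : X.PosSemidef) : ∃ P : Matrix (Fin n) (Fin n) ℝ, P.PosSemidef ∧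
      P * M + Mᵀ * P + X = 0 := by
  let T : Matrix (Fin n) (Fin n) ℝ →ₗ[ℝ] Matrix (Fin n) (Fin n) ℝ :=
    LinearMap.mulRight ℝ M + LinearMap.mulLeft ℝ Mᵀ
  have hT : ∀ P, T P = P * M + Mᵀ * P := fun P => rfl
  have hinj : Function.Injective T := by
    rw [injective_iff_map_eq_zero]
    exact fun P hP => h.eq_zero_of_lyapunov hP
  obtain ⟨P, hP⟩ := LinearMap.injective_iff_surjective.1 hinj (-X)
  have hXt : Xᵀ = X := by simpa using hX.1.eq
  have hPt : Pᵀ = P := by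
    apply hinj
    rw [hP, hT]
    have := congrArg transpose hP
    rw [hT, transpose_add, transpose_mul, transpose_mul, transpose_transpose, transpose_neg,
      hXt] at this
    rw [← this, add_comm]
  rw [hT] at hP
  refine ⟨P, h.posSemidef_of_lyapunov ?_ ?_, by rw [hP]; simp⟩
  · rw [IsHermitian, conjTranspose_eq_transpose_of_trivial, hPt]
  · rw [hP, neg_neg]; exact hX

/-! ### Kernels, invariant subspaces and the Kalman rank conditions -/

lemma posSemidef_transpose_mul_mul {R : Matrix (Fin m) (Fin m) ℝ} (hR : R.PosSemidef)
    (K : Matrix (Fin m) (Fin n) ℝ) : (Kᵀ * R * K).PosSemidef := by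
  simpa using hR.conjTranspose_mul_mul_same K

lemma mulVec_eq_zero_of_add {Y Z : Matrix (Fin n) (Fin n) ℝ} (hY : Y.PosSemidef)
    (hZ : Z.PosSemidef) {v : Fin n → ℝ} (h : (Y + Z) *ᵥ v = 0) : Y *ᵥ v = 0 ∧ Z *ᵥ v = 0 := by
  have h1 := hY.dotProduct_mulVec_nonneg v
  have h2 := hZ.dotProduct_mulVec_nonneg v
  have h3 : star v ⬝ᵥ Y *ᵥ v + star v ⬝ᵥ Z *ᵥ v = 0 := by
    rw [← dotProduct_add, ← add_mulVec, h, dotProduct_zero]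
  exact ⟨(hY.dotProduct_mulVec_zero_iff v).1 (by linarith),
    (hZ.dotProduct_mulVec_zero_iff v).1 (by linarith)⟩

lemma mulVec_eq_zero_of_transpose_mul_mul {R : Matrix (Fin m) (Fin m) ℝ} (hR : R.PosDef)
    {K : Matrix (Fin m) (Fin n) ℝ} {v : Fin n → ℝ} (h : (Kᵀ * R * K) *ᵥ v = 0) :
    K *ᵥ v = 0 := by
  by_contra hne
  have hpos := hR.dotProduct_mulVec_pos hne
  have h0 : v ⬝ᵥ (Kᵀ * R * K) *ᵥ v = 0 := by rw [h, dotProduct_zero]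
  rw [Matrix.mul_assoc, ← mulVec_mulVec, dotProduct_mulVec, vecMul_transpose,
    ← mulVec_mulVec] at h0
  simp only [star_trivial] at hpos
  exact hpos.ne' h0

lemma eq_zero_of_mulVec_of_rank {ι : Type*} [Fintype ι] {M : Matrix ι (Fin n) ℝ}
    (hM : M.rank = n) {w : Fin n → ℝ} (h : M *ᵥ w = 0) : w = 0 := by
  have h1 := LinearMap.finrank_range_add_finrank_ker M.mulVecLin
  have h2 : Module.finrank ℝ (LinearMap.range M.mulVecLin) = n := hM
  rw [h2, Module.finrank_fin_fun] at h1
  have h3 : LinearMap.ker M.mulVecLin = ⊥ := Submodule.finrank_eq_zero.1 (by omega)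
  have : w ∈ LinearMap.ker M.mulVecLin := h
  simpa [h3] using this

lemma isUnit_det_of_rank {A : Matrix (Fin n) (Fin n) ℝ} (hA : A.rank = n) : IsUnit A.det := by
  rw [isUnit_iff_ne_zero]
  intro h0
  obtain ⟨v, hv, h⟩ := Matrix.exists_mulVec_eq_zero_iff.2 h0
  exact hv (eq_zero_of_mulVec_of_rank hA h)

/-- An injective endomorphism of the finite-dimensional `W` is onto. The Riccati equation yields
invariance under `A⁻¹`, while the rank conditions speak of `A`. -/
lemma mulVec_mem_of_inv_invariant {A : Matrix (Fin n) (Fin n) ℝ} (hA : IsUnit A.det)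
    {W : Submodule ℝ (Fin n → ℝ)} (hW : ∀ w ∈ W, A⁻¹ *ᵥ w ∈ W) {w : Fin n → ℝ} (hw : w ∈ W) :
    A *ᵥ w ∈ W := by
  let f : W →ₗ[ℝ] W := (A⁻¹).mulVecLin.restrict hW
  have hf : ∀ u : W, (f u : Fin n → ℝ) = A⁻¹ *ᵥ (u : Fin n → ℝ) := fun u => rfl
  have hAf : ∀ u : W, A *ᵥ (f u : Fin n → ℝ) = u := fun u => by
    rw [hf, mulVec_mulVec, Matrix.mul_nonsing_inv _ hA, one_mulVec]
  have hinj : Function.Injective f := fun u v huv => by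
    rw [Subtype.ext_iff, ← hAf u, huv, hAf v]
  obtain ⟨u, hu⟩ := LinearMap.injective_iff_surjective.1 hinj ⟨w, hw⟩
  have := hAf u
  rw [hu] at this
  change A *ᵥ w = u at this
  rw [this]
  exact u.2

lemma pow_mulVec_mem {A : Matrix (Fin n) (Fin n) ℝ} {W : Submodule ℝ (Fin n → ℝ)}
    (hW : ∀ w ∈ W, A *ᵥ w ∈ W) {w : Fin n → ℝ} (hw : w ∈ W) (k : ℕ) : A ^ k *ᵥ w ∈ W := by
  induction k with
  | zero => simpa using hw
  | succ k ih =>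
    rw [pow_succ', ← mulVec_mulVec]
    exact hW _ ih

/-- For a controllable pair, no nonzero `Aᵀ`-invariant subspace lies in the kernel of `Bᵀ`. -/
lemma IsControllable.eq_zero_of_mem {A : Matrix (Fin n) (Fin n) ℝ}
    {B : Matrix (Fin n) (Fin m) ℝ} (h : IsControllable A B) {W : Submodule ℝ (Fin n → ℝ)}
    (hW : ∀ w ∈ W, Aᵀ *ᵥ w ∈ W) (hB : ∀ w ∈ W, Bᵀ *ᵥ w = 0) {w : Fin n → ℝ} (hw : w ∈ W) :
    w = 0 := by
  rw [IsControllable, ← rank_transpose] at h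
  refine eq_zero_of_mulVec_of_rank h ?_
  ext ⟨k, j⟩
  have h1 := congrFun (hB _ (pow_mulVec_mem hW hw (k : ℕ))) j
  rw [mulVec_mulVec, ← transpose_pow, ← transpose_mul] at h1
  exact h1

/-- For an observable pair, no nonzero `A`-invariant subspace lies in the kernel of `C`. -/
lemma IsObservable.eq_zero_of_mem {A C : Matrix (Fin n) (Fin n) ℝ}
    (h : IsObservable C A) {W : Submodule ℝ (Fin n → ℝ)}
    (hW : ∀ w ∈ W, A *ᵥ w ∈ W) (hC : ∀ w ∈ W, C *ᵥ w = 0) {w : Fin n → ℝ} (hw : w ∈ W) :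
    w = 0 := by
  refine eq_zero_of_mulVec_of_rank h ?_
  ext ⟨k, j⟩
  have h1 := congrFun (hC _ (pow_mulVec_mem hW hw (k : ℕ))) j
  rw [mulVec_mulVec] at h1
  exact h1

/-- For an eigenvector `v = a + ib`, the equation gives `2α v*Pv + v*Xv = 0`. If `0 ≤ α`, both terms
vanish and `X` kills `v`. Thus `hker` is a detectability condition. -/
lemma isHurwitz_of_lyapunov {M P X : Matrix (Fin n) (Fin n) ℝ} (hP : P.PosSemidef)
    (hX : X.PosSemidef) (h : P * M + Mᵀ * P + X = 0)
    (hker : ∀ (a b : Fin n → ℝ) (α β : ℝ), M *ᵥ a = α • a - β • b → M *ᵥ b = β • a + α • b →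
      0 ≤ α → X *ᵥ a = 0 → X *ᵥ b = 0 → a = 0 ∧ b = 0) : IsHurwitz M := by
  rw [isHurwitz_iff]
  intro a b α β ha hb hα
  have hq : ∀ v : Fin n → ℝ,
      v ⬝ᵥ P *ᵥ (M *ᵥ v) + (M *ᵥ v) ⬝ᵥ P *ᵥ v + v ⬝ᵥ X *ᵥ v = 0 := by
    intro v
    have h1 := congrArg (fun Y => v ⬝ᵥ Y *ᵥ v) h
    simp only [add_mulVec, dotProduct_add, zero_mulVec, dotProduct_zero, ← mulVec_mulVec] at h1
    rwa [dotProduct_mulVec v Mᵀ, vecMul_transpose] at h1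
  have hqa := hq a
  have hqb := hq b
  simp only [ha, hb, mulVec_add, mulVec_sub, mulVec_smul, dotProduct_add, dotProduct_sub,
    dotProduct_smul, add_dotProduct, sub_dotProduct, smul_dotProduct, smul_eq_mul] at hqa hqb
  have p1 := hP.dotProduct_mulVec_nonneg a
  have p2 := hP.dotProduct_mulVec_nonneg b
  have x1 := hX.dotProduct_mulVec_nonneg a
  have x2 := hX.dotProduct_mulVec_nonneg b
  have z1 := hX.dotProduct_mulVec_zero_iff a
  have z2 := hX.dotProduct_mulVec_zero_iff b
  simp only [star_trivial] at p1 p2 x1 x2 z1 z2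
  have q1 := mul_nonneg hα p1
  have q2 := mul_nonneg hα p2
  -- The cross terms in `β` cancel when `hqa` and `hqb` are added.
  exact hker a b α β ha hb hα (z1.1 (by linarith)) (z2.1 (by linarith))

/-! ### Riccati equation, policy evaluation and policy improvement -/

section Riccati

variable {A Q P P' : Matrix (Fin n) (Fin n) ℝ} {B : Matrix (Fin n) (Fin m) ℝ}
  {R : Matrix (Fin m) (Fin m) ℝ} {K : Matrix (Fin m) (Fin n) ℝ}

/-- Completion of squares for the Lyapunov residual. -/
lemma lyapunov_eq_riccati_add (hR : R.PosDef) (hP : P.IsHermitian) :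
    P * closedLoopInv A B K + (closedLoopInv A B K)ᵀ * P + Q + Kᵀ * R * K =
      (P * A⁻¹ + A⁻¹ᵀ * P - P * A⁻¹ * B * R⁻¹ * Bᵀ * A⁻¹ᵀ * P + Q) +
        (K - gain A B R P)ᵀ * R * (K - gain A B R P) := by
  have hRu : IsUnit R.det := (isUnit_iff_isUnit_det R).1 hR.isUnit
  have hRt : R⁻¹ᵀ = R⁻¹ := by
    rw [transpose_nonsing_inv]
    congr 1
    simpa using hR.1.eq
  have hPt : Pᵀ = P := by simpa using hP.eq
  simp only [closedLoopInv, gain, sub_neg_eq_add, transpose_add, transpose_mul,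
    transpose_transpose, hRt, hPt, Matrix.mul_add, Matrix.add_mul, Matrix.mul_one,
    Matrix.mul_assoc, Matrix.nonsing_inv_mul_cancel_left _ _ hRu,
    Matrix.mul_nonsing_inv_cancel_left _ _ hRu]
  abel

lemma solvesARE_iff_solvesLyapunov (hR : R.PosDef) (hP : P.IsHermitian) :
    SolvesARE A B Q R P ↔ SolvesLyapunov A B Q R (gain A B R P) P := by
  rw [SolvesLyapunov, lyapunov_eq_riccati_add hR hP, sub_self, Matrix.mul_zero, add_zero]
  rfl

lemma exists_solvesLyapunov (hQ : Q.PosSemidef) (hR : R.PosDef)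
    (hK : IsHurwitz (closedLoopInv A B K)) :
    ∃ P : Matrix (Fin n) (Fin n) ℝ, P.PosSemidef ∧ SolvesLyapunov A B Q R K P := by
  obtain ⟨P, hP, h⟩ := hK.exists_lyapunov (hQ.add (posSemidef_transpose_mul_mul hR.posSemidef K))
  exact ⟨P, hP, by rw [SolvesLyapunov, add_assoc _ Q]; exact h⟩

lemma SolvesLyapunov.unique (hK : IsHurwitz (closedLoopInv A B K))
    (h : SolvesLyapunov A B Q R K P) (h' : SolvesLyapunov A B Q R K P') : P = P' := by
  rw [SolvesLyapunov] at h h'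
  rw [← sub_eq_zero]
  apply hK.eq_zero_of_lyapunov
  rw [Matrix.sub_mul, Matrix.mul_sub, ← sub_eq_zero.2 (h.trans h'.symm)]
  abel

/-- A solution of the Lyapunov equation dominates every solution of the Riccati equation. -/
lemma SolvesLyapunov.sub_posSemidef_of_solvesARE (hR : R.PosDef)
    (hK : IsHurwitz (closedLoopInv A B K)) (hP : P.IsHermitian) (hP' : P'.IsHermitian)
    (h : SolvesLyapunov A B Q R K P) (h' : SolvesARE A B Q R P') : (P - P').PosSemidef := by
  -- The Lyapunov residual of `P - P'` is minus the square in `K - gain A B R P'`.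
  refine hK.posSemidef_of_lyapunov (hP.sub hP') ?_
  have e := lyapunov_eq_riccati_add (A := A) (B := B) (Q := Q) (K := K) hR hP'
  rw [SolvesARE] at h'
  rw [h', zero_add] at e
  rw [SolvesLyapunov] at h
  have := posSemidef_transpose_mul_mul hR.posSemidef (K - gain A B R P')
  rw [← e] at this
  convert this using 1
  rw [Matrix.sub_mul, Matrix.mul_sub, ← sub_zero (P' * _ + _ + Q + _), ← h]
  abel

/-- Policy improvement does not increase the cost. -/
lemma SolvesLyapunov.sub_posSemidef_of_gain (hR : R.PosDef) (hP : P.IsHermitian)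
    (hP' : P'.IsHermitian) (hK : IsHurwitz (closedLoopInv A B (gain A B R P)))
    (h : SolvesLyapunov A B Q R K P) (h' : SolvesLyapunov A B Q R (gain A B R P) P') :
    (P - P').PosSemidef := by
  refine hK.posSemidef_of_lyapunov (hP.sub hP') ?_
  have e1 := lyapunov_eq_riccati_add (A := A) (B := B) (Q := Q) (K := K) hR hP
  have e2 := lyapunov_eq_riccati_add (A := A) (B := B) (Q := Q) (K := gain A B R P) hR hP
  rw [sub_self, Matrix.mul_zero, add_zero] at e2
  rw [SolvesLyapunov] at h h'
  rw [h, ← e2] at e1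
  have := posSemidef_transpose_mul_mul hR.posSemidef (K - gain A B R P)
  rw [← neg_eq_of_add_eq_zero_right e1.symm] at this
  convert this using 1
  rw [Matrix.sub_mul, Matrix.mul_sub, ← sub_zero (P * _ + _ + Q + _), ← h']
  abel

lemma closedLoopInv_mulVec (v : Fin n → ℝ) :
    closedLoopInv A B K *ᵥ v = A⁻¹ *ᵥ v + A⁻¹ *ᵥ (B *ᵥ (K *ᵥ v)) := by
  rw [closedLoopInv, Matrix.mul_add, add_mulVec, Matrix.mul_one]
  simp only [mulVec_mulVec]

/-- Policy improvement preserves stability. -/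
lemma SolvesLyapunov.isHurwitz_gain (hQ : Q.PosSemidef) (hR : R.PosDef)
    (hK : IsHurwitz (closedLoopInv A B K)) (hP : P.PosSemidef)
    (h : SolvesLyapunov A B Q R K P) : IsHurwitz (closedLoopInv A B (gain A B R P)) := by
  set L := gain A B R P with hL
  have e1 := lyapunov_eq_riccati_add (A := A) (B := B) (Q := Q) (K := K) hR hP.1
  have e2 := lyapunov_eq_riccati_add (A := A) (B := B) (Q := Q) (K := L) hR hP.1
  rw [SolvesLyapunov] at h
  rw [← hL] at e1 e2
  rw [sub_self, Matrix.mul_zero, add_zero] at e2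
  rw [h, ← e2] at e1
  have s1 := hQ.add (posSemidef_transpose_mul_mul hR.posSemidef L)
  have s2 := posSemidef_transpose_mul_mul hR.posSemidef (K - L)
  refine isHurwitz_of_lyapunov hP (s1.add s2) (by rw [e1]; abel) ?_
  -- Where the square in `K - L` vanishes, both gains agree, so an unstable mode of the new loop
  -- would be one of the old loop.
  have hker : ∀ v, (Q + Lᵀ * R * L + (K - L)ᵀ * R * (K - L)) *ᵥ v = 0 →
      closedLoopInv A B L *ᵥ v = closedLoopInv A B K *ᵥ v := by
    intro v hv
    obtain ⟨h1, h2⟩ := mulVec_eq_zero_of_add s1 s2 hv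
    have h4 := mulVec_eq_zero_of_transpose_mul_mul hR h2
    rw [sub_mulVec, sub_eq_zero] at h4
    rw [closedLoopInv_mulVec, closedLoopInv_mulVec, h4]
  intro a b α β ha hb hα hXa hXb
  rw [hker a hXa] at ha
  rw [hker b hXb] at hb
  exact isHurwitz_iff.1 hK a b α β ha hb hα

/-- A positive definite solution of the Riccati equation is stabilizing. -/
lemma SolvesARE.isHurwitz (hA : IsUnit A.det) (hAB : IsControllable A B) (hQ : Q.PosSemidef)
    (hR : R.PosDef) (hP : P.PosDef) (h : SolvesARE A B Q R P) :
    IsHurwitz (closedLoopInv A B (gain A B R P)) := by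
  have hl := (solvesARE_iff_solvesLyapunov hR hP.1).1 h
  rw [SolvesLyapunov, add_assoc _ Q] at hl
  have s := posSemidef_transpose_mul_mul hR.posSemidef (gain A B R P)
  refine isHurwitz_of_lyapunov hP.posSemidef (hQ.add s) hl ?_
  intro a b α β ha hb hα hXa hXb
  have hAt : IsUnit Aᵀ.det := by rwa [det_transpose]
  have hRu : IsUnit R.det := (isUnit_iff_isUnit_det R).1 hR.isUnit
  have hker : ∀ v, (Q + (gain A B R P)ᵀ * R * gain A B R P) *ᵥ v = 0 →
      Bᵀ *ᵥ (A⁻¹ᵀ *ᵥ (P *ᵥ v)) = 0 ∧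
        A⁻¹ᵀ *ᵥ (P *ᵥ v) = -(P *ᵥ (closedLoopInv A B (gain A B R P) *ᵥ v)) := by
    intro v hv
    obtain ⟨h1, h2⟩ := mulVec_eq_zero_of_add hQ s hv
    have h3 := mulVec_eq_zero_of_transpose_mul_mul hR h2
    have h4 : (Bᵀ * A⁻¹ᵀ * P) *ᵥ v = 0 := by
      have : Bᵀ * A⁻¹ᵀ * P = -(R * gain A B R P) := by
        simp only [gain, Matrix.mul_neg, neg_neg, Matrix.mul_assoc,
          Matrix.mul_nonsing_inv_cancel_left _ _ hRu]
      rw [this, neg_mulVec, ← mulVec_mulVec, h3, mulVec_zero, neg_zero]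
    have h5 : Bᵀ *ᵥ (A⁻¹ᵀ *ᵥ (P *ᵥ v)) = 0 := by
      rwa [mulVec_mulVec, mulVec_mulVec, Matrix.mul_assoc] at *
    refine ⟨h5, ?_⟩
    have h6 := congrArg (· *ᵥ v) hl
    simp only [add_mulVec, zero_mulVec, h1, h2, add_zero, ← mulVec_mulVec] at h6
    have h7 : (closedLoopInv A B (gain A B R P))ᵀ *ᵥ (P *ᵥ v) = A⁻¹ᵀ *ᵥ (P *ᵥ v) := by
      rw [closedLoopInv, transpose_mul, transpose_add, ← mulVec_mulVec, add_mulVec,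
        transpose_mul, transpose_one, one_mulVec, ← mulVec_mulVec _ _ Bᵀ, h5, mulVec_zero,
        add_zero]
    rw [h7] at h6
    exact eq_neg_of_add_eq_zero_right h6
  obtain ⟨Ba, Fa⟩ := hker a hXa
  obtain ⟨Bb, Fb⟩ := hker b hXb
  rw [ha, mulVec_sub, mulVec_smul, mulVec_smul] at Fa
  rw [hb, mulVec_add, mulVec_smul, mulVec_smul] at Fb
  -- An unstable mode gives a subspace invariant under `A⁻ᵀ` on which `Bᵀ A⁻ᵀ` vanishes.
  -- Controllability forces it to be zero.
  set W := Submodule.span ℝ {P *ᵥ a, P *ᵥ b} with hWdef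
  have ma : P *ᵥ a ∈ W := Submodule.subset_span (by simp)
  have mb : P *ᵥ b ∈ W := Submodule.subset_span (by simp)
  have hW : ∀ w ∈ W, (Aᵀ)⁻¹ *ᵥ w ∈ W ∧ Bᵀ *ᵥ ((Aᵀ)⁻¹ *ᵥ w) = 0 := by
    rw [← transpose_nonsing_inv]
    intro w hw
    obtain ⟨s, t, rfl⟩ := Submodule.mem_span_pair.1 hw
    simp only [mulVec_add, mulVec_smul, Ba, Bb, smul_zero, add_zero, and_true]
    rw [Fa, Fb]
    exact W.add_mem (W.smul_mem _ (W.neg_mem (W.sub_mem (W.smul_mem _ ma) (W.smul_mem _ mb))))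
      (W.smul_mem _ (W.neg_mem (W.add_mem (W.smul_mem _ ma) (W.smul_mem _ mb))))
  have hWA : ∀ w ∈ W, Aᵀ *ᵥ w ∈ W := fun w hw =>
    mulVec_mem_of_inv_invariant hAt (fun w hw => (hW w hw).1) hw
  have hWB : ∀ w ∈ W, Bᵀ *ᵥ w = 0 := fun w hw => by
    have := (hW _ (hWA w hw)).2
    rwa [mulVec_mulVec w, Matrix.nonsing_inv_mul _ hAt, one_mulVec] at this
  have hinj : ∀ v, P *ᵥ v ∈ W → v = 0 := fun v hv => by
    have hz := hAB.eq_zero_of_mem hWA hWB hv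
    by_contra hne
    have := hP.dotProduct_mulVec_pos hne
    rw [hz, dotProduct_zero] at this
    exact lt_irrefl _ this
  exact ⟨hinj a ma, hinj b mb⟩

/-- Under observability a positive semidefinite solution of the Riccati equation is definite. -/
lemma SolvesARE.posDef {S : Matrix (Fin n) (Fin n) ℝ} (hA : IsUnit A.det) (hS : S.PosSemidef)
    (hSQ : S * S = Q) (hobs : IsObservable S A) (hP : P.PosSemidef)
    (h : SolvesARE A B Q R P) : P.PosDef := by
  have hSt : Sᵀ = S := by simpa using hS.1.eq
  have hPt : Pᵀ = P := by simpa using hP.1.eq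
  -- The quadratic form of the Riccati equation at `v` reduces to `vᵀ Q v = 0`. Then only `P A⁻¹ v =
  -- 0` is left of the equation at `v`, so the kernel of `P` is unobservable.
  have hker : ∀ v, P *ᵥ v = 0 → S *ᵥ v = 0 ∧ P *ᵥ (A⁻¹ *ᵥ v) = 0 := by
    intro v hv
    have h1 := congrArg (· *ᵥ v) h
    simp only [add_mulVec, sub_mulVec, zero_mulVec, ← mulVec_mulVec, hv, mulVec_zero, add_zero,
      sub_zero] at h1
    have h2 : v ⬝ᵥ P *ᵥ (A⁻¹ *ᵥ v) = 0 := by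
      rw [dotProduct_mulVec, ← mulVec_transpose, hPt, hv, zero_dotProduct]
    have h3 : v ⬝ᵥ Q *ᵥ v = 0 := by
      have := congrArg (v ⬝ᵥ ·) h1
      simpa only [dotProduct_add, h2, zero_add, dotProduct_zero] using this
    have h4 : S *ᵥ v = 0 := by
      rw [← hSQ, ← mulVec_mulVec, dotProduct_mulVec, ← mulVec_transpose, hSt] at h3
      exact dotProduct_self_eq_zero.1 h3
    refine ⟨h4, ?_⟩
    rwa [← hSQ, ← mulVec_mulVec, h4, mulVec_zero, add_zero] at h1
  refine PosDef.of_dotProduct_mulVec_pos hP.1 fun x hx => ?_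
  refine lt_of_le_of_ne (hP.dotProduct_mulVec_nonneg x) fun h0 => hx ?_
  refine hobs.eq_zero_of_mem (W := LinearMap.ker P.mulVecLin)
    (fun w hw => mulVec_mem_of_inv_invariant hA (fun w hw => (hker w hw).2) hw)
    (fun w hw => (hker w hw).1) ?_
  exact (hP.dotProduct_mulVec_zero_iff x).1 h0.symm

lemma SolvesARE.unique (hA : IsUnit A.det) (hAB : IsControllable A B) (hQ : Q.PosSemidef)
    (hR : R.PosDef) (hP : P.PosDef) (h : SolvesARE A B Q R P) (hP' : P'.PosDef)
    (h' : SolvesARE A B Q R P') : P = P' := by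
  have h1 := ((solvesARE_iff_solvesLyapunov hR hP.1).1 h).sub_posSemidef_of_solvesARE hR
    (h.isHurwitz hA hAB hQ hR hP) hP.1 hP'.1 h'
  have h2 := ((solvesARE_iff_solvesLyapunov hR hP'.1).1 h').sub_posSemidef_of_solvesARE hR
    (h'.isHurwitz hA hAB hQ hR hP') hP'.1 hP.1 h
  open scoped MatrixOrder in
  exact le_antisymm (Matrix.le_iff.2 h2) (Matrix.le_iff.2 h1)

lemma IsStabilizing.isHurwitz_closedLoopInv (hA : IsUnit A.det) (hK : IsStabilizing A B K) :
    IsHurwitz (closedLoopInv A B K) := by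
  refine hK.2.of_mul_eq_one ?_
  rw [closedLoopInv, Matrix.mul_assoc, Matrix.mul_nonsing_inv_cancel_left _ _ hA,
    Matrix.nonsing_inv_mul _ hK.1]

lemma isStabilizing_of_isHurwitz (hA : IsUnit A.det) (hK : IsHurwitz (closedLoopInv A B K)) :
    IsStabilizing A B K := by
  have h1 : 1 + B * K = A * closedLoopInv A B K := by
    rw [closedLoopInv, Matrix.mul_nonsing_inv_cancel_left _ _ hA]
  have hu : IsUnit (1 + B * K).det := by
    rw [h1, det_mul]
    exact hA.mul hK.isUnit_det
  refine ⟨hu, hK.of_mul_eq_one ?_⟩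
  rw [closedLoopInv, Matrix.mul_assoc, Matrix.mul_nonsing_inv_cancel_left _ _ hu,
    Matrix.nonsing_inv_mul _ hA]

end Riccati

/-! ### Limits of monotone matrix sequences -/

lemma posSemidef_of_tendsto {P : ℕ → Matrix (Fin n) (Fin n) ℝ} {L : Matrix (Fin n) (Fin n) ℝ}
    (hP : ∀ i, (P i).PosSemidef) (hL : Tendsto P atTop (𝓝 L)) : L.PosSemidef := by
  refine PosSemidef.of_dotProduct_mulVec_nonneg ?_ fun x => ?_
  · have hc : Continuous fun Y : Matrix (Fin n) (Fin n) ℝ => Yᴴ := by fun_prop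
    exact tendsto_nhds_unique (((hc.tendsto L).comp hL).congr fun i => (hP i).1) hL
  · have hc : Continuous fun Y : Matrix (Fin n) (Fin n) ℝ => star x ⬝ᵥ Y *ᵥ x := by fun_prop
    exact ge_of_tendsto' ((hc.tendsto L).comp hL) fun i => (hP i).dotProduct_mulVec_nonneg x

/-- A decreasing sequence of positive semidefinite matrices converges. -/
lemma exists_tendsto_of_antitone_posSemidef {P : ℕ → Matrix (Fin n) (Fin n) ℝ}
    (hP : ∀ i, (P i).PosSemidef) (hmono : ∀ i, (P i - P (i + 1)).PosSemidef) :
    ∃ L : Matrix (Fin n) (Fin n) ℝ, L.PosSemidef ∧ Tendsto P atTop (𝓝 L) := by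
  have hq : ∀ x : Fin n → ℝ, ∃ l, Tendsto (fun i => x ⬝ᵥ P i *ᵥ x) atTop (𝓝 l) := by
    intro x
    refine ⟨_, tendsto_atTop_ciInf (antitone_nat_of_succ_le fun i => ?_)
      ⟨0, by rintro _ ⟨i, rfl⟩; simpa using (hP i).dotProduct_mulVec_nonneg x⟩⟩
    have := (hmono i).dotProduct_mulVec_nonneg x
    rw [sub_mulVec, dotProduct_sub, star_trivial] at this
    linarith
  choose q hq using hq
  -- Polarization recovers the entries from the convergent quadratic forms.
  have hent : ∀ i j k, P i j k = ((Pi.single j 1 + Pi.single k 1) ⬝ᵥ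
      P i *ᵥ (Pi.single j 1 + Pi.single k 1) - Pi.single j 1 ⬝ᵥ P i *ᵥ Pi.single j 1 -
      Pi.single k 1 ⬝ᵥ P i *ᵥ Pi.single k 1) / 2 := by
    intro i j k
    have hs : P i k j = P i j k := by simpa using (hP i).1.apply j k
    simp [mulVec_add, hs]
    ring
  let L : Matrix (Fin n) (Fin n) ℝ := fun j k =>
    (q (Pi.single j 1 + Pi.single k 1) - q (Pi.single j 1) - q (Pi.single k 1)) / 2
  have hL : Tendsto P atTop (𝓝 L) := by
    refine tendsto_pi_nhds.2 fun j => tendsto_pi_nhds.2 fun k => ?_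
    simp only [hent]
    exact (((hq _).sub (hq _)).sub (hq _)).div_const 2
  exact ⟨L, posSemidef_of_tendsto hP hL, hL⟩

/-! ### Policy iteration, indexed from `0` -/

section Iteration

variable {A Q : Matrix (Fin n) (Fin n) ℝ} {B : Matrix (Fin n) (Fin m) ℝ}
  {R : Matrix (Fin m) (Fin m) ℝ} {P : ℕ → Matrix (Fin n) (Fin n) ℝ}
  {K : ℕ → Matrix (Fin m) (Fin n) ℝ}

lemma continuous_gain : Continuous (gain A B R) := by
  unfold gain
  fun_prop

lemma isHurwitz_policyIteration (hQ : Q.PosSemidef) (hR : R.PosDef)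
    (h0 : IsHurwitz (closedLoopInv A B (K 0))) (hP : ∀ i, (P i).PosSemidef)
    (hL : ∀ i, SolvesLyapunov A B Q R (K i) (P i)) (hK : ∀ i, K (i + 1) = gain A B R (P i))
    (i : ℕ) : IsHurwitz (closedLoopInv A B (K i)) := by
  induction i with
  | zero => exact h0
  | succ i ih =>
    rw [hK]
    exact (hL i).isHurwitz_gain hQ hR ih (hP i)

lemma antitone_policyIteration (hQ : Q.PosSemidef) (hR : R.PosDef)
    (h0 : IsHurwitz (closedLoopInv A B (K 0))) (hP : ∀ i, (P i).PosSemidef)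
    (hL : ∀ i, SolvesLyapunov A B Q R (K i) (P i)) (hK : ∀ i, K (i + 1) = gain A B R (P i))
    (i : ℕ) : (P i - P (i + 1)).PosSemidef :=
  (hL i).sub_posSemidef_of_gain hR (hP i).1 (hP (i + 1)).1
    (hK i ▸ isHurwitz_policyIteration hQ hR h0 hP hL hK (i + 1)) (hK i ▸ hL (i + 1))

lemma exists_tendsto_policyIteration (hQ : Q.PosSemidef) (hR : R.PosDef)
    (h0 : IsHurwitz (closedLoopInv A B (K 0))) (hP : ∀ i, (P i).PosSemidef)
    (hL : ∀ i, SolvesLyapunov A B Q R (K i) (P i)) (hK : ∀ i, K (i + 1) = gain A B R (P i)) :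
    ∃ L : Matrix (Fin n) (Fin n) ℝ, L.PosSemidef ∧ SolvesARE A B Q R L ∧
      Tendsto P atTop (𝓝 L) := by
  obtain ⟨L, hLpos, hlim⟩ := exists_tendsto_of_antitone_posSemidef hP
    (antitone_policyIteration hQ hR h0 hP hL hK)
  refine ⟨L, hLpos, (solvesARE_iff_solvesLyapunov hR hLpos.1).2 ?_, hlim⟩
  -- In the limit of the evaluation equations, `L` is evaluated at its own gain, which is the
  -- Riccati equation.
  have hc : Continuous fun Y : Matrix (Fin m) (Fin n) ℝ × Matrix (Fin n) (Fin n) ℝ =>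
      Y.2 * closedLoopInv A B Y.1 + (closedLoopInv A B Y.1)ᵀ * Y.2 + Q + Y.1ᵀ * R * Y.1 := by
    unfold closedLoopInv
    fun_prop
  have hK' : Tendsto (fun i => K (i + 1)) atTop (𝓝 (gain A B R L)) :=
    ((continuous_gain.tendsto L).comp hlim).congr fun i => (hK i).symm
  have hlim2 := (hc.tendsto (gain A B R L, L)).comp
    (hK'.prodMk_nhds (hlim.comp (tendsto_add_atTop_nat 1)))
  exact tendsto_nhds_unique (hlim2.congr fun i => hL (i + 1)) tendsto_const_nhds

/-- Stability travels with the gain in a subtype, so each step has a Lyapunov solution to choose. -/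
lemma exists_policyIteration (hQ : Q.PosSemidef) (hR : R.PosDef)
    {K₁ : Matrix (Fin m) (Fin n) ℝ} (h0 : IsHurwitz (closedLoopInv A B K₁)) :
    ∃ (P : ℕ → Matrix (Fin n) (Fin n) ℝ) (K : ℕ → Matrix (Fin m) (Fin n) ℝ), K 0 = K₁ ∧
      (∀ i, (P i).PosSemidef) ∧ (∀ i, SolvesLyapunov A B Q R (K i) (P i)) ∧
      ∀ i, K (i + 1) = gain A B R (P i) := by
  have hex : ∀ K : {K : Matrix (Fin m) (Fin n) ℝ // IsHurwitz (closedLoopInv A B K)},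
      ∃ P : Matrix (Fin n) (Fin n) ℝ, P.PosSemidef ∧ SolvesLyapunov A B Q R K P :=
    fun K => exists_solvesLyapunov hQ hR K.2
  choose p hp hpl using hex
  let next : {K : Matrix (Fin m) (Fin n) ℝ // IsHurwitz (closedLoopInv A B K)} →
      {K : Matrix (Fin m) (Fin n) ℝ // IsHurwitz (closedLoopInv A B K)} :=
    fun K => ⟨gain A B R (p K), (hpl K).isHurwitz_gain hQ hR K.2 (hp K)⟩
  refine ⟨fun i => p (next^[i] ⟨K₁, h0⟩), fun i => next^[i] ⟨K₁, h0⟩, rfl, fun i => hp _,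
    fun i => hpl _, fun i => ?_⟩
  simp only [Function.iterate_succ_apply']
  rfl

end Iteration

end DFC

theorem theorem1 {n m : ℕ}
    (A : Matrix (Fin n) (Fin n) ℝ) (B : Matrix (Fin n) (Fin m) ℝ)
    (Q : Matrix (Fin n) (Fin n) ℝ) (R : Matrix (Fin m) (Fin m) ℝ)
    (hA : A.rank = n) (hAB : DFC.IsControllable A B)
    (hQ : Q.PosSemidef) (hR : R.PosDef)
    (K₁ : Matrix (Fin m) (Fin n) ℝ) (hK₁ : DFC.IsStabilizing A B K₁) :
    -- if `(Q^{1/2}, A)` is observable, the Riccati equation has a positive definite solution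
    (∀ S : Matrix (Fin n) (Fin n) ℝ, S.PosSemidef → S * S = Q → DFC.IsObservable S A →
      ∃ Pstar : Matrix (Fin n) (Fin n) ℝ, Pstar.PosDef ∧ DFC.SolvesARE A B Q R Pstar) ∧
    -- whenever there is one, it is unique and policy iteration is well defined and converges to it
    ∀ Pstar : Matrix (Fin n) (Fin n) ℝ, Pstar.PosDef → DFC.SolvesARE A B Q R Pstar →
      (∀ P' : Matrix (Fin n) (Fin n) ℝ, P'.PosDef → DFC.SolvesARE A B Q R P' → P' = Pstar) ∧
      (∃ (P : ℕ → Matrix (Fin n) (Fin n) ℝ) (K : ℕ → Matrix (Fin m) (Fin n) ℝ),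
        DFC.IsPolicyIteration A B Q R K₁ P K) ∧
      ∀ (P : ℕ → Matrix (Fin n) (Fin n) ℝ) (K : ℕ → Matrix (Fin m) (Fin n) ℝ),
        DFC.IsPolicyIteration A B Q R K₁ P K →
        (∀ i, 1 ≤ i → ∀ P' : Matrix (Fin n) (Fin n) ℝ, P'.PosDef →
          DFC.SolvesLyapunov A B Q R (K i) P' → P' = P i) ∧
        (∀ i, 1 ≤ i → IsUnit (1 + B * K (i + 1)).det ∧
          DFC.IsHurwitz ((1 + B * K (i + 1))⁻¹ * A)) ∧
        (∀ i, 1 ≤ i → (P (i + 1) - Pstar).PosSemidef ∧ (P i - P (i + 1)).PosSemidef) ∧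
        Tendsto P atTop (𝓝 Pstar) ∧
        Tendsto K atTop (𝓝 (DFC.gain A B R Pstar)) := by
  have hAu := DFC.isUnit_det_of_rank hA
  have h0 := hK₁.isHurwitz_closedLoopInv hAu
  obtain ⟨P₀, K₀, hK0, hP, hL, hI⟩ := DFC.exists_policyIteration hQ hR h0
  rw [← hK0] at h0
  refine ⟨fun S hS hSQ hobs => ?_, fun Pstar hPs hare => ⟨fun P' hP' h' =>
    h'.unique hAu hAB hQ hR hP' hPs hare, ?_, ?_⟩⟩
  · obtain ⟨L, hLpos, hLare, -⟩ := DFC.exists_tendsto_policyIteration hQ hR h0 hP hL hI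
    exact ⟨L, hLare.posDef hAu hS hSQ hobs hLpos, hLare⟩
  · refine ⟨fun i => P₀ (i - 1), fun i => K₀ (i - 1), ⟨hK0, fun i _ => ?_, fun i _ => hL _,
      fun i hi => ?_⟩⟩
    -- Definiteness of the iterates comes from dominating `Pstar`; no observability is needed.
    · have := (hL (i - 1)).sub_posSemidef_of_solvesARE hR
        (DFC.isHurwitz_policyIteration hQ hR h0 hP hL hI _) (hP _).1 hPs.1 hare
      simpa using hPs.add_posSemidef this
    · obtain ⟨j, rfl⟩ := Nat.exists_eq_add_of_le' hi
      exact hI j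
  · intro P K hPI
    have hP1 : ∀ i, (P (i + 1)).PosDef := fun i => hPI.posDef _ (by omega)
    have hL1 : ∀ i, DFC.SolvesLyapunov A B Q R (K (i + 1)) (P (i + 1)) :=
      fun i => hPI.evaluation _ (by omega)
    have hI1 : ∀ i, K (i + 1 + 1) = DFC.gain A B R (P (i + 1)) :=
      fun i => hPI.improvement _ (by omega)
    have h01 : DFC.IsHurwitz (DFC.closedLoopInv A B (K (0 + 1))) := by
      rw [zero_add, hPI.init, ← hK0]
      exact h0
    have hH := DFC.isHurwitz_policyIteration (P := fun i => P (i + 1))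
      (K := fun i => K (i + 1)) hQ hR h01 (fun i => (hP1 i).posSemidef) hL1 hI1
    have hmono := DFC.antitone_policyIteration (P := fun i => P (i + 1))
      (K := fun i => K (i + 1)) hQ hR h01 (fun i => (hP1 i).posSemidef) hL1 hI1
    obtain ⟨L, -, hLare, hlim⟩ := DFC.exists_tendsto_policyIteration
      (P := fun i => P (i + 1)) (K := fun i => K (i + 1)) hQ hR h01
      (fun i => (hP1 i).posSemidef) hL1 hI1
    have hge : ∀ i, (P (i + 1) - Pstar).PosSemidef := fun i =>
      (hL1 i).sub_posSemidef_of_solvesARE hR (hH i) (hP1 i).1 hPs.1 hare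
    have hLPs : (L - Pstar).PosSemidef :=
      DFC.posSemidef_of_tendsto hge (hlim.sub_const Pstar)
    have hLd : L.PosDef := by simpa using hPs.add_posSemidef hLPs
    obtain rfl := hLare.unique hAu hAB hQ hR hLd hPs hare
    have hlimP : Tendsto P atTop (𝓝 L) := (tendsto_add_atTop_iff_nat 1).1 hlim
    refine ⟨fun i hi P' hP' h' => ?_, fun i hi => ?_, fun i hi => ⟨hge i, ?_⟩, hlimP, ?_⟩
    · obtain ⟨j, rfl⟩ := Nat.exists_eq_add_of_le' hi
      exact h'.unique (hH j) (hL1 j)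
    · exact DFC.isStabilizing_of_isHurwitz hAu (hH i)
    · obtain ⟨j, rfl⟩ := Nat.exists_eq_add_of_le' hi
      exact hmono j
    -- The shift is two because `K 0` and `K 1` are not produced by improvement.
    · refine (tendsto_add_atTop_iff_nat 2).1 ?_
      exact ((DFC.continuous_gain.tendsto L).comp hlim).congr fun i => (hI1 i).symm
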